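/- Let $\mathcal H_1,\mathcal H_2,\mathcal H_3$ be finite-dimensional complex Hilbert spaces and let $\rho_{123}$ be an invertible density operator on $\mathcal H_1\otimes\mathcal H_2\otimes\mathcal H_3$ (positive definite, of trace $1$). Let $\rho_{12}=\operatorname{Tr}_3\rho_{123}$, $\rho_{23}=\operatorname{Tr}_1\rho_{123}$ and $\rho_2=\operatorname{Tr}_3\rho_{23}$ be its reduced densities, and let $I_3$ be the identity on $\mathcal H_3$. For $x>0$ put $\ln_q x=\frac{x^{q-1}-1}{q-1}$ if $q\neq 1$ and $\ln_1 x=\ln x$, and let $S_q(D)=-\operatorname{Tr} D\ln_q D$ be the Tsallis entropy of a density $D$. For positive definite $\rho,\sigma$, an operator $A$ on the same space and $f:(0,\infty)\to\mathbb R$, let $$S_f^A(\rho\,\|\,\sigma)=\left\langle A\rho^{1/2},\, f(\Delta(\sigma/\rho))\,(A\rho^{1/2})\right\rangle,\qquad \langle X,Y\rangle=\operatorname{Tr}X^*Y,$$ where $\Delta(\sigma/\rho)$ is the relative modular operator $X\mapsto\sigma X\rho^{-1}$. Then for every $0<q\le 2$, $$S_q(\rho_{12})+S_q(\rho_{23})-S_q(\rho_{123})-S_q(\rho_2)\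 \ge\ (q-1)\left(S_{\ln_q}^{(-\ln_q\rho_{123})^{1/2}}\big(\rho_{123}\,\|\,\rho_{12}\otimes I_3\big)-S_{\ln_q}^{(-\ln_q\rho_{23})^{1/2}}\big(\rho_{23}\,\|\,\rho_2\otimes I_3\big)\right).$$ In particular, for $q=1$ this gives the strong subadditivity $S(\rho_{123})+S(\rho_2)\le S(\rho_{12})+S(\rho_{23})$ of the von Neumann entropy $S(D)=-\operatorname{Tr}D\ln D$ of such $\rho_{123}$. -/

import Mathlib

open scoped Kronecker Matrix ComplexOrder

noncomputable section

/-- The deformed logarithm `ln_q x = ∫ t in 1..x, t ^ (q - 2)`, for `x > 0`. -/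
def qLog (q x : ℝ) : ℝ :=
  if q = 1 then Real.log x else (x ^ (q - 1) - 1) / (q - 1)

/-- The partial trace over the right tensor factor. -/
def partialTraceRight {m n : Type*} [Fintype n] (A : Matrix (m × n) (m × n) ℂ) : Matrix m m ℂ :=
  Matrix.of fun i j => ∑ k, A (i, k) (j, k)

/-- The partial trace over the left tensor factor. -/
def partialTraceLeft {m n : Type*} [Fintype m] (A : Matrix (m × n) (m × n) ℂ) : Matrix n n ℂ :=
  Matrix.of fun i j => ∑ k, A (k, i) (k, j)

section Reduced

variable {n₁ n₂ n₃ : Type*}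

/-- The reduced matrix `ρ₁₂ = Tr₃ ρ₁₂₃`. -/
def reduced12 [Fintype n₃] (ρ : Matrix ((n₁ × n₂) × n₃) ((n₁ × n₂) × n₃) ℂ) :
    Matrix (n₁ × n₂) (n₁ × n₂) ℂ :=
  partialTraceRight ρ

/-- The reduced matrix `ρ₂₃ = Tr₁ ρ₁₂₃`. -/
def reduced23 [Fintype n₁] (ρ : Matrix ((n₁ × n₂) × n₃) ((n₁ × n₂) × n₃) ℂ) :
    Matrix (n₂ × n₃) (n₂ × n₃) ℂ :=
  partialTraceLeft (Matrix.reindex (Equiv.prodAssoc n₁ n₂ n₃) (Equiv.prodAssoc n₁ n₂ n₃) ρ)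

/-- The reduced matrix `ρ₂ = Tr₃ ρ₂₃ = Tr₁ Tr₃ ρ₁₂₃`. -/
def reduced2 [Fintype n₁] [Fintype n₃] (ρ : Matrix ((n₁ × n₂) × n₃) ((n₁ × n₂) × n₃) ℂ) :
    Matrix n₂ n₂ ℂ :=
  partialTraceRight (reduced23 ρ)

end Reduced

section Entropy

variable {n : Type*} [Fintype n] [DecidableEq n]

/-- The Tsallis entropy `S_q(D) = - Tr D ln_q D`. The trace is real when `D` is Hermitian. -/
def tsallisEntropy (q : ℝ) (D : Matrix n n ℂ) : ℝ :=
  -((D * cfc (qLog q) D).trace).re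

/-- The von Neumann entropy `S(D) = - Tr D log D`. The trace is real when `D` is Hermitian. -/
def vonNeumannEntropy (D : Matrix n n ℂ) : ℝ :=
  -((D * cfc Real.log D).trace).re

/-- The relative modular operator `Δ(σ/ρ) : X ↦ σ X ρ⁻¹`. -/
def relativeModularOperator (ρ σ : Matrix n n ℂ) : Matrix n n ℂ →ₗ[ℂ] Matrix n n ℂ where
  toFun X := σ * X * ρ⁻¹
  map_add' X Y := by rw [Matrix.mul_add, Matrix.add_mul]
  map_smul' c X := by rw [Matrix.mul_smul, Matrix.smul_mul, RingHom.id_apply]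

/-- `f(T)` for a linear operator `T` on the matrix space that is self-adjoint for the
Hilbert-Schmidt inner product `⟨X, Y⟩ = Tr Xᴴ Y`. It is computed in the basis of matrix units,
which is orthonormal for this inner product. -/
def superoperatorCfc (f : ℝ → ℝ) (T : Matrix n n ℂ →ₗ[ℂ] Matrix n n ℂ) :
    Matrix n n ℂ →ₗ[ℂ] Matrix n n ℂ :=
  Matrix.toLin (Matrix.stdBasis ℂ n n) (Matrix.stdBasis ℂ n n)
    (cfc f (LinearMap.toMatrix (Matrix.stdBasis ℂ n n) (Matrix.stdBasis ℂ n n) T))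

/-- The relative quasi-entropy `S_f^A(ρ ‖ σ) = ⟨A ρ^(1/2), f(Δ(σ/ρ)) (A ρ^(1/2))⟩`, where
`⟨X, Y⟩ = Tr Xᴴ Y`, for positive definite `ρ` and `σ`. The trace is then real. -/
def relativeQuasiEntropy (f : ℝ → ℝ) (A ρ σ : Matrix n n ℂ) : ℝ :=
  (((A * cfc Real.sqrt ρ)ᴴ *
    superoperatorCfc f (relativeModularOperator ρ σ) (A * cfc Real.sqrt ρ)).trace).re

/-- The weight `(- ln_q ρ)^(1/2)`; here `- ln_q ρ` is positive semidefinite when `0 < ρ ≤ 1`. -/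
def sqrtNegQLog (q : ℝ) (ρ : Matrix n n ℂ) : Matrix n n ℂ :=
  cfc Real.sqrt (-cfc (qLog q) ρ)

end Entropy

end

/-! # Strong subadditivity of the Tsallis entropy with a quasi-entropic correction

The deformed addition rule `ln_q (u r) = ln_q u + ln_q r + (q - 1) ln_q u ln_q r` shows that
`(q - 1)` times the quasi-entropy of `ρ` and `σ` with weight `(- ln_q ρ)^(1/2)` equals
`S_{ln_q}(ρ ‖ σ) - Tr ρ ln_q σ - S_q(ρ)`, where the first term has weight `1`
(`sub_one_mul_relativeQuasiEntropy`). For `σ = ρ₁₂ ⊗ I₃` the second term is `S_q(ρ₁₂)`,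
and similarly for `ρ₂₃` and `ρ₂ ⊗ I₃`. All entropies
then cancel, and what is left is the monotonicity
`S_{ln_q}(ρ₁₂₃ ‖ ρ₁₂ ⊗ I₃) ≤ S_{ln_q}(ρ₂₃ ‖ ρ₂ ⊗ I₃)` under the partial trace over the first factor
(`relativeQuasiEntropy_qLog_mono`).

For the monotonicity, `ln_q` with `0 < q ≤ 2` is, up to an affine function, a positive integral of
the functions `x ↦ - (t + x)⁻¹`, or a limit of such, or affine itself (`sum_mul_qLog_le`). The
affine part gives traces of `ρ` and `σ`, which the partial trace preserves. The resolvent part is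
the maximum over `Y` of
`2 Re Tr ρ Y - Tr σ Y Yᴴ - t Tr ρ Yᴴ Y` (`resolventFunctional_le`, `exists_resolventFunctional_eq`),
and on matrices `I₁ ⊗ Y` this functional only sees the reduced matrices, so the maximum can only
decrease under the partial trace.

Both steps are carried out in eigenbases of `ρ` and `σ`, where the quasi-entropy is the sum of
`r_j f(s_i / r_j)` with the squared overlaps of the eigenvectors as weights
(`relativeQuasiEntropy_conjDiagonal`).
-/

/-! ### Sums of deformed logarithms -/

section Scalar

open Real MeasureTheory Set Filter Topology

variable {ι κ : Type*} [Fintype ι] [Fintype κ]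

/-- Inequalities between sums of the integrands that represent `x ↦ x ^ p` integrate to
inequalities between sums of `p`-th powers. -/
lemma sum_mul_rpow_le_of_rpowIntegrand {p : ℝ} (hp : p ∈ Ioo 0 1) {a x : ι → ℝ} {b y : κ → ℝ}
    (hx : ∀ i, 0 < x i) (hy : ∀ k, 0 < y k)
    (h : ∀ t, 0 < t →
      ∑ i, a i * rpowIntegrand₀₁ p t (x i) ≤ ∑ k, b k * rpowIntegrand₀₁ p t (y k)) :
    ∑ i, a i * x i ^ p ≤ ∑ k, b k * y k ^ p := by
  have hC : 0 ≤ (∫ t in Ioi 0, rpowIntegrand₀₁ p t 1)⁻¹ :=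
    inv_nonneg.2 (integral_rpowIntegrand₀₁_one_pos hp).le
  have hia : ∀ i ∈ Finset.univ, Integrable (fun t => a i * rpowIntegrand₀₁ p t (x i))
      (volume.restrict (Ioi 0)) := fun i _ =>
    (integrableOn_rpowIntegrand₀₁_Ioi hp (hx i).le).const_mul _
  have hib : ∀ k ∈ Finset.univ, Integrable (fun t => b k * rpowIntegrand₀₁ p t (y k))
      (volume.restrict (Ioi 0)) := fun k _ =>
    (integrableOn_rpowIntegrand₀₁_Ioi hp (hy k).le).const_mul _
  have key := setIntegral_mono_on (integrable_finsetSum _ hia) (integrable_finsetSum _ hib)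
    measurableSet_Ioi (fun t ht => h t ht)
  rw [integral_finsetSum _ hia, integral_finsetSum _ hib] at key
  simp only [integral_const_mul] at key
  calc ∑ i, a i * x i ^ p
      = (∫ t in Ioi 0, rpowIntegrand₀₁ p t 1)⁻¹ *
          ∑ i, a i * ∫ t in Ioi 0, rpowIntegrand₀₁ p t (x i) := by
        rw [Finset.mul_sum]
        refine Finset.sum_congr rfl fun i _ => ?_
        rw [rpow_eq_const_mul_integral hp (hx i).le]; ring
    _ ≤ (∫ t in Ioi 0, rpowIntegrand₀₁ p t 1)⁻¹ *
          ∑ k, b k * ∫ t in Ioi 0, rpowIntegrand₀₁ p t (y k) :=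
        mul_le_mul_of_nonneg_left key hC
    _ = ∑ k, b k * y k ^ p := by
        rw [Finset.mul_sum]
        refine Finset.sum_congr rfl fun k _ => ?_
        rw [rpow_eq_const_mul_integral hp (hy k).le]; ring

lemma sum_mul_qLog_of_ne_one {q : ℝ} (hq : q ≠ 1) (a x : ι → ℝ) :
    ∑ i, a i * qLog q (x i) = (∑ i, a i * x i ^ (q - 1) - ∑ i, a i) / (q - 1) := by
  rw [← Finset.sum_sub_distrib, Finset.sum_div]
  refine Finset.sum_congr rfl fun i _ => ?_
  rw [qLog, if_neg hq]; ring

lemma tendsto_qLog_one {x : ℝ} (hx : 0 < x) :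
    Tendsto (fun q => qLog q x) (𝓝[≠] 1) (𝓝 (qLog 1 x)) := by
  have hd : HasDerivAt (fun q : ℝ => x ^ (q - 1)) (log x) 1 := by
    have := (((hasDerivAt_id (1 : ℝ)).sub_const 1).const_rpow hx)
    simpa using this
  rw [hasDerivAt_iff_tendsto_slope] at hd
  have h1 : qLog 1 x = log x := by simp [qLog]
  rw [h1]
  refine hd.congr' ?_
  filter_upwards [self_mem_nhdsWithin] with q hq
  have hq' : q ≠ 1 := hq
  simp [qLog, hq', slope_def_field]

/-- Two finite families of weighted points with the same mass and the same first moment, whose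
resolvent transforms are ordered, have ordered means of the deformed logarithm. This is where the
range `0 < q ≤ 2` enters: there `ln_q` is an integral, with positive weight, of the functions
`x ↦ - (t + x)⁻¹`, up to an affine function. -/
lemma sum_mul_qLog_le {q : ℝ} (hq₀ : 0 < q) (hq₂ : q ≤ 2) {a x : ι → ℝ} {b y : κ → ℝ}
    (hx : ∀ i, 0 < x i) (hy : ∀ k, 0 < y k) (hmass : ∑ i, a i = ∑ k, b k)
    (hmean : ∑ i, a i * x i = ∑ k, b k * y k)
    (hres : ∀ t, 0 < t → ∑ k, b k * (t + y k)⁻¹ ≤ ∑ i, a i * (t + x i)⁻¹) :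
    ∑ i, a i * qLog q (x i) ≤ ∑ k, b k * qLog q (y k) := by
  have hne : ∀ r : ℝ, 0 < r → r < 2 → r ≠ 1 →
      ∑ i, a i * qLog r (x i) ≤ ∑ k, b k * qLog r (y k) := by
    intro r hr0 hr2 hr1
    rw [sum_mul_qLog_of_ne_one hr1, sum_mul_qLog_of_ne_one hr1, hmass]
    rcases lt_or_gt_of_ne hr1 with hlt | hgt
    · -- Here `x ^ (r - 1) = x ^ r / x`, so the weights `- a i / x i` represent `- x ^ (r - 1)`.
      have hp : r ∈ Ioo (0 : ℝ) 1 := ⟨hr0, hlt⟩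
      have hq : ∀ t : ℝ, 0 < t → ∀ z : ℝ, 0 < z →
          rpowIntegrand₀₁ r t z = t ^ r * t⁻¹ * (z * (t + z)⁻¹) := by
        intro t ht z hz
        have : t + z ≠ 0 := by positivity
        rw [rpowIntegrand₀₁]; field_simp; ring
      have := sum_mul_rpow_le_of_rpowIntegrand hp (a := fun i => -(a i / x i))
        (b := fun k => -(b k / y k)) hx hy (by
          intro t ht
          have e1 : ∀ i, -(a i / x i) * rpowIntegrand₀₁ r t (x i)
              = -(t ^ r * t⁻¹) * (a i * (t + x i)⁻¹) := by
            intro i; have := (hx i).ne'; rw [hq t ht _ (hx i)]; field_simp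
          have e2 : ∀ k, -(b k / y k) * rpowIntegrand₀₁ r t (y k)
              = -(t ^ r * t⁻¹) * (b k * (t + y k)⁻¹) := by
            intro i; have := (hy i).ne'; rw [hq t ht _ (hy i)]; field_simp
          simp only [e1, e2, ← Finset.mul_sum]
          have : 0 ≤ t ^ r * t⁻¹ := by positivity
          nlinarith [mul_le_mul_of_nonneg_left (hres t ht) this])
      have e1 : ∀ i, -(a i / x i) * x i ^ r = -(a i * x i ^ (r - 1)) := by
        intro i; have := (hx i).ne'; rw [rpow_sub_one this]; field_simp
      have e2 : ∀ k, -(b k / y k) * y k ^ r = -(b k * y k ^ (r - 1)) := by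
        intro i; have := (hy i).ne'; rw [rpow_sub_one this]; field_simp
      simp only [e1, e2, Finset.sum_neg_distrib] at this
      refine div_le_div_of_nonpos_of_le (by linarith) (by linarith)
    · have hp : r - 1 ∈ Ioo (0 : ℝ) 1 := ⟨by linarith, by linarith⟩
      have := sum_mul_rpow_le_of_rpowIntegrand hp (a := a) (b := b) hx hy (by
        intro t ht
        have e1 : ∀ i, a i * rpowIntegrand₀₁ (r - 1) t (x i)
            = t ^ (r - 1) * t⁻¹ * a i - t ^ (r - 1) * (a i * (t + x i)⁻¹) := by
          intro i; rw [rpowIntegrand₀₁]; ring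
        have e2 : ∀ k, b k * rpowIntegrand₀₁ (r - 1) t (y k)
            = t ^ (r - 1) * t⁻¹ * b k - t ^ (r - 1) * (b k * (t + y k)⁻¹) := by
          intro i; rw [rpowIntegrand₀₁]; ring
        simp only [e1, e2, Finset.sum_sub_distrib, ← Finset.mul_sum, hmass]
        have : 0 ≤ t ^ (r - 1) := by positivity
        linarith [mul_le_mul_of_nonneg_left (hres t ht) this])
      have h1 : 0 ≤ r - 1 := by linarith
      gcongr
  rcases eq_or_lt_of_le hq₂ with rfl | hlt
  · have : (2 : ℝ) - 1 = 1 := by norm_num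
    simp only [qLog, this, rpow_one, div_one, OfNat.ofNat_ne_one, if_false, mul_sub, mul_one,
      Finset.sum_sub_distrib, hmass, hmean]
    exact le_rfl
  by_cases h1 : q = 1
  · subst h1
    refine le_of_tendsto_of_tendsto
      (tendsto_finsetSum _ fun i _ => (tendsto_qLog_one (hx i)).const_mul (a i))
      (tendsto_finsetSum _ fun k _ => (tendsto_qLog_one (hy k)).const_mul (b k)) ?_
    filter_upwards [self_mem_nhdsWithin, nhdsWithin_le_nhds (Ioo_mem_nhds hq₀ hlt)] with r hr hr'
    exact hne r hr'.1 hr'.2 hr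
  · exact hne q hq₀ hlt h1

/-- The deformed addition rule `ln_q (u r) = ln_q u + ln_q r + (q - 1) ln_q u ln_q r`, multiplied
by `r`. -/
lemma mul_qLog_div (q : ℝ) {r s : ℝ} (hr : 0 < r) (hs : 0 < s) :
    (q - 1) * (r * -qLog q r * qLog q (s / r)) =
      r * qLog q (s / r) - r * qLog q s + r * qLog q r := by
  by_cases h : q = 1
  · subst h
    simp only [qLog, if_true, log_div hs.ne' hr.ne']; ring
  · have hq : q - 1 ≠ 0 := sub_ne_zero.2 h
    have h1 : r ^ (q - 1) ≠ 0 := (rpow_pos_of_pos hr _).ne'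
    simp only [qLog, if_neg h, div_rpow hs.le hr.le]
    field_simp
    ring

lemma qLog_nonpos (q : ℝ) {x : ℝ} (hx : 0 < x) (hx1 : x ≤ 1) : qLog q x ≤ 0 := by
  rw [qLog]
  split_ifs with h
  · exact log_nonpos hx.le hx1
  · rcases lt_or_gt_of_ne h with h | h
    · exact div_nonpos_of_nonneg_of_nonpos
        (by linarith [one_le_rpow_of_pos_of_le_one_of_nonpos hx hx1 (by linarith : q - 1 ≤ 0)])
        (by linarith)
    · exact div_nonpos_of_nonpos_of_nonneg
        (by linarith [rpow_le_one hx.le hx1 (by linarith : 0 ≤ q - 1)]) (by linarith)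

end Scalar

/-! ### Functional calculus of diagonalised matrices -/

section Diagonalization

variable {n m : Type*} [Fintype n] [DecidableEq n] [Fintype m] [DecidableEq m]

/-- The matrix `U diag(d) Uᴴ`. -/
def conjDiagonal (U : Matrix n n ℂ) (d : n → ℝ) : Matrix n n ℂ :=
  U * Matrix.diagonal (fun i => (d i : ℂ)) * Uᴴ

lemma exists_eq_conjDiagonal {A : Matrix n n ℂ} (hA : A.PosDef) :
    ∃ (U : Matrix n n ℂ) (d : n → ℝ), Uᴴ * U = 1 ∧ (∀ i, 0 < d i) ∧ A = conjDiagonal U d :=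
  ⟨hA.1.eigenvectorUnitary, hA.1.eigenvalues, by
    simpa [Matrix.star_eq_conjTranspose] using
      Unitary.coe_star_mul_self hA.1.eigenvectorUnitary, hA.eigenvalues_pos, by
    conv_lhs => rw [hA.1.spectral_theorem]
    rfl⟩

lemma isHermitian_conjDiagonal (U : Matrix n n ℂ) (d : n → ℝ) : (conjDiagonal U d).IsHermitian := by
  have h : (Matrix.diagonal (fun i => (d i : ℂ)))ᴴ = Matrix.diagonal (fun i => (d i : ℂ)) := by
    rw [Matrix.diagonal_conjTranspose]; congr 1; ext i; simp
  rw [Matrix.IsHermitian, conjDiagonal, Matrix.conjTranspose_mul, Matrix.conjTranspose_mul,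
    Matrix.conjTranspose_conjTranspose, h, Matrix.mul_assoc]

lemma conjDiagonal_mul_conjDiagonal {U : Matrix n n ℂ} (hU : Uᴴ * U = 1) (d e : n → ℝ) :
    conjDiagonal U d * conjDiagonal U e = conjDiagonal U (fun i => d i * e i) := by
  have h : (Matrix.diagonal fun i => ((d i * e i : ℝ) : ℂ)) =
      Matrix.diagonal (fun i => (d i : ℂ)) * Matrix.diagonal (fun i => (e i : ℂ)) := by
    rw [Matrix.diagonal_mul_diagonal]; simp
  calc conjDiagonal U d * conjDiagonal U e
      = U * Matrix.diagonal (fun i => (d i : ℂ)) * (Uᴴ * U) *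
          Matrix.diagonal (fun i => (e i : ℂ)) * Uᴴ := by
        simp only [conjDiagonal, Matrix.mul_assoc]
    _ = _ := by rw [hU, conjDiagonal, h]; simp only [Matrix.mul_assoc, Matrix.one_mul]

lemma conjDiagonal_add (U : Matrix n n ℂ) (d e : n → ℝ) :
    conjDiagonal U d + conjDiagonal U e = conjDiagonal U (fun i => d i + e i) := by
  simp only [conjDiagonal, Complex.ofReal_add, ← Matrix.diagonal_add]
  rw [Matrix.mul_add, Matrix.add_mul]

lemma conjDiagonal_neg (U : Matrix n n ℂ) (d : n → ℝ) :
    -conjDiagonal U d = conjDiagonal U (fun i => -d i) := by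
  simp only [conjDiagonal, Complex.ofReal_neg, ← Matrix.diagonal_neg]
  rw [Matrix.mul_neg, Matrix.neg_mul]

lemma conjDiagonal_const {U : Matrix n n ℂ} (hU : Uᴴ * U = 1) (c : ℝ) :
    conjDiagonal U (fun _ => c) = algebraMap ℝ (Matrix n n ℂ) c := by
  have hU' : U * Uᴴ = 1 := mul_eq_one_comm.1 hU
  have : Matrix.diagonal (fun _ : n => (c : ℂ)) = (c : ℂ) • (1 : Matrix n n ℂ) := by
    rw [Matrix.smul_one_eq_diagonal]
  rw [conjDiagonal, this, Matrix.mul_smul, Matrix.mul_one, Matrix.smul_mul, hU',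
    Algebra.algebraMap_eq_smul_one]
  ext i j; simp

open Polynomial in
lemma aeval_conjDiagonal {U : Matrix n n ℂ} (hU : Uᴴ * U = 1) (d : n → ℝ) (p : ℝ[X]) :
    aeval (conjDiagonal U d) p = conjDiagonal U (fun i => p.eval (d i)) := by
  induction p using Polynomial.induction_on with
  | C a => simp [conjDiagonal_const hU]
  | add p q hp hq => simp [hp, hq, conjDiagonal_add]
  | monomial k a h =>
    rw [pow_succ, ← mul_assoc, map_mul, h, aeval_X, conjDiagonal_mul_conjDiagonal hU]
    simp [mul_assoc]

/-- The functional calculus acts on the diagonal. No continuity is needed, since `f` agrees with a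
polynomial on a finite set. -/
lemma cfc_conjDiagonal {U : Matrix n n ℂ} (hU : Uᴴ * U = 1) (d : n → ℝ) (f : ℝ → ℝ) :
    cfc f (conjDiagonal U d) = conjDiagonal U (fun i => f (d i)) := by
  classical
  have hfin : (spectrum ℝ (conjDiagonal U d)).Finite := Matrix.finite_real_spectrum
  let s : Finset ℝ := hfin.toFinset ∪ Finset.univ.image d
  have hs : ∀ z ∈ s, (Lagrange.interpolate s id f).eval z = f z := fun z hz =>
    Lagrange.eval_interpolate_at_node f (Set.injOn_id _) hz
  have hsa : IsSelfAdjoint (conjDiagonal U d) := isHermitian_conjDiagonal U d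
  rw [cfc_congr (g := (Lagrange.interpolate s id f).eval) fun z hz =>
      (hs z (Finset.mem_union_left _ (hfin.mem_toFinset.2 hz))).symm,
    cfc_polynomial _ _ hsa, aeval_conjDiagonal hU]
  congr 1
  ext i
  exact hs _ (Finset.mem_union_right _ (Finset.mem_image_of_mem _ (Finset.mem_univ i)))

lemma trace_conjDiagonal {U : Matrix n n ℂ} (hU : Uᴴ * U = 1) (d : n → ℝ) :
    (conjDiagonal U d).trace = ∑ i, (d i : ℂ) := by
  rw [conjDiagonal, Matrix.trace_mul_cycle, hU, Matrix.one_mul, Matrix.trace_diagonal]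

lemma conjDiagonal_inv {U : Matrix n n ℂ} (hU : Uᴴ * U = 1) {d : n → ℝ} (hd : ∀ i, d i ≠ 0) :
    (conjDiagonal U d)⁻¹ = conjDiagonal U (fun i => (d i)⁻¹) := by
  refine Matrix.inv_eq_right_inv ?_
  rw [conjDiagonal_mul_conjDiagonal hU]
  simp only [mul_inv_cancel₀ (hd _)]
  rw [conjDiagonal_const hU, map_one]

lemma conjDiagonal_kronecker (U : Matrix n n ℂ) (V : Matrix m m ℂ) (d : n → ℝ) (e : m → ℝ) :
    conjDiagonal U d ⊗ₖ conjDiagonal V e =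
      conjDiagonal (U ⊗ₖ V) (fun ij => d ij.1 * e ij.2) := by
  have h : (Matrix.diagonal fun ij : n × m => ((d ij.1 * e ij.2 : ℝ) : ℂ)) =
      Matrix.diagonal (fun i => (d i : ℂ)) ⊗ₖ Matrix.diagonal (fun i => (e i : ℂ)) := by
    rw [Matrix.diagonal_kronecker_diagonal]; simp
  simp only [conjDiagonal]
  rw [h, Matrix.conjTranspose_kronecker, Matrix.mul_kronecker_mul, Matrix.mul_kronecker_mul]

lemma kronecker_conjTranspose_mul_self {U : Matrix n n ℂ} {V : Matrix m m ℂ} (hU : Uᴴ * U = 1)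
    (hV : Vᴴ * V = 1) : (U ⊗ₖ V)ᴴ * (U ⊗ₖ V) = 1 := by
  rw [Matrix.conjTranspose_kronecker, ← Matrix.mul_kronecker_mul, hU, hV, Matrix.one_kronecker_one]

lemma cfc_kronecker_one {A : Matrix n n ℂ} (hA : A.PosDef) (f : ℝ → ℝ) :
    cfc f (A ⊗ₖ (1 : Matrix m m ℂ)) = cfc f A ⊗ₖ (1 : Matrix m m ℂ) := by
  obtain ⟨U, d, hU, -, rfl⟩ := exists_eq_conjDiagonal hA
  have h1 : (1 : Matrix m m ℂ)ᴴ * 1 = 1 := by simp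
  have h : (1 : Matrix m m ℂ) = conjDiagonal 1 (fun _ => 1) := by
    rw [conjDiagonal_const h1, map_one]
  have hUV := kronecker_conjTranspose_mul_self hU h1
  conv_lhs => rw [h, conjDiagonal_kronecker, cfc_conjDiagonal hUV]
  conv_rhs => rw [h, cfc_conjDiagonal hU, conjDiagonal_kronecker]
  simp

end Diagonalization

/-! ### Relative quasi-entropy in eigenbases -/

section QuasiEntropy

variable {n : Type*} [Fintype n] [DecidableEq n]

lemma transpose_conjDiagonal (U : Matrix n n ℂ) (d : n → ℝ) :
    (conjDiagonal U d)ᵀ = conjDiagonal Uᴴᵀ d := by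
  rw [conjDiagonal, conjDiagonal, Matrix.transpose_mul, Matrix.transpose_mul,
    Matrix.diagonal_transpose, ← Matrix.mul_assoc]
  congr 1
  ext i j; simp

lemma toMatrix_relativeModularOperator (ρ σ : Matrix n n ℂ) :
    LinearMap.toMatrix (Matrix.stdBasis ℂ n n) (Matrix.stdBasis ℂ n n)
      (relativeModularOperator ρ σ) = σ ⊗ₖ (ρ⁻¹)ᵀ := by
  ext ⟨i, j⟩ ⟨k, l⟩
  rw [LinearMap.toMatrix_apply, Matrix.stdBasis_eq_single]
  change (σ * Matrix.single k l (1 : ℂ) * ρ⁻¹ : Matrix n n ℂ) i j = _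
  simp [Matrix.mul_apply, Matrix.single_apply, Finset.sum_ite_eq, ite_and]

lemma toLin_stdBasis_apply (K : Matrix (n × n) (n × n) ℂ) (X : Matrix n n ℂ) (i j : n) :
    Matrix.toLin (Matrix.stdBasis ℂ n n) (Matrix.stdBasis ℂ n n) K X i j =
      ∑ kl : n × n, K (i, j) kl * X kl.1 kl.2 := by
  have := LinearMap.toMatrix_mulVec_repr (Matrix.stdBasis ℂ n n) (Matrix.stdBasis ℂ n n)
    (Matrix.toLin (Matrix.stdBasis ℂ n n) (Matrix.stdBasis ℂ n n) K) X
  rw [LinearMap.toMatrix_toLin] at this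
  exact (congrFun this (i, j)).symm

lemma toLin_kronecker_apply (A B X : Matrix n n ℂ) :
    Matrix.toLin (Matrix.stdBasis ℂ n n) (Matrix.stdBasis ℂ n n) (A ⊗ₖ B) X = A * X * Bᵀ := by
  ext i j
  rw [toLin_stdBasis_apply, Fintype.sum_prod_type, Finset.sum_comm]
  simp only [Matrix.mul_apply, Matrix.transpose_apply, Matrix.kroneckerMap_apply, Finset.sum_mul]
  refine Finset.sum_congr rfl fun k _ => Finset.sum_congr rfl fun l _ => ?_
  ring

lemma toLin_diagonal_apply (d : n × n → ℂ) (X : Matrix n n ℂ) :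
    Matrix.toLin (Matrix.stdBasis ℂ n n) (Matrix.stdBasis ℂ n n) (Matrix.diagonal d) X =
      Matrix.of fun i j => d (i, j) * X i j := by
  ext i j
  rw [toLin_stdBasis_apply, Finset.sum_eq_single (i, j)]
  · simp
  · intro b _ hb
    simp [Matrix.diagonal_apply_ne _ hb.symm]
  · simp

/-- In eigenbases of `σ` and `ρ`, the relative modular operator multiplies the entries of a matrix
by the ratios of the eigenvalues, and its functional calculus acts accordingly. -/
lemma superoperatorCfc_relativeModularOperator {U W : Matrix n n ℂ} (hU : Uᴴ * U = 1)
    (hW : Wᴴ * W = 1) {r s : n → ℝ} (hr : ∀ j, 0 < r j) (f : ℝ → ℝ) (X : Matrix n n ℂ) :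
    superoperatorCfc f (relativeModularOperator (conjDiagonal W r) (conjDiagonal U s)) X =
      U * (Matrix.of fun i j => (f (s i / r j) : ℂ) * (Uᴴ * X * W) i j) * Wᴴ := by
  have hWt : Wᴴᵀᴴ * Wᴴᵀ = 1 := by
    have h : Wᴴᵀᴴ = Wᵀ := by ext i j; simp
    rw [h, ← Matrix.transpose_mul, hW, Matrix.transpose_one]
  have e : Wᴴᵀᴴᵀ = W := by ext i j; simp
  rw [superoperatorCfc, toMatrix_relativeModularOperator, conjDiagonal_inv hW fun j => (hr j).ne',
    transpose_conjDiagonal, conjDiagonal_kronecker,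
    cfc_conjDiagonal (kronecker_conjTranspose_mul_self hU hWt), conjDiagonal,
    Matrix.toLin_mul _ (Matrix.stdBasis ℂ n n), Matrix.toLin_mul _ (Matrix.stdBasis ℂ n n),
    Matrix.conjTranspose_kronecker, LinearMap.comp_apply, LinearMap.comp_apply,
    toLin_kronecker_apply, toLin_diagonal_apply, toLin_kronecker_apply, e,
    Matrix.transpose_transpose]
  simp only [div_eq_mul_inv]

/-- The trace pairing of a matrix that is diagonal in the basis `W` with a matrix `U Z Wᴴ`. -/
lemma trace_conjDiagonal_mul {U W : Matrix n n ℂ} (hW : Wᴴ * W = 1) (r : n → ℝ)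
    (Z : Matrix n n ℂ) :
    (conjDiagonal W r * (U * Z * Wᴴ)).trace =
      ∑ i, ∑ j, (r j : ℂ) * (star ((Uᴴ * W) i j) * Z i j) := by
  have h : (conjDiagonal W r * (U * Z * Wᴴ)).trace =
      (Matrix.diagonal (fun i => (r i : ℂ)) * ((Uᴴ * W)ᴴ * Z)).trace := by
    calc _ = (W * (Matrix.diagonal (fun i => (r i : ℂ)) * (Wᴴ * U * Z)) * Wᴴ).trace := by
          simp only [conjDiagonal, Matrix.mul_assoc]
      _ = _ := by
          rw [Matrix.trace_mul_cycle, hW, Matrix.one_mul, Matrix.conjTranspose_mul,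
            Matrix.conjTranspose_conjTranspose]
  rw [h, Finset.sum_comm]
  simp only [Matrix.trace, Matrix.diag_apply, Matrix.diagonal_mul, Matrix.mul_apply (M := (_)ᴴ),
    Matrix.conjTranspose_apply, Finset.mul_sum]

lemma mul_conjTranspose_mul_mul {U W : Matrix n n ℂ} (hU : Uᴴ * U = 1) (hW : Wᴴ * W = 1)
    (Y : Matrix n n ℂ) : U * (Uᴴ * Y * W) * Wᴴ = Y := by
  calc U * (Uᴴ * Y * W) * Wᴴ = (U * Uᴴ) * Y * (W * Wᴴ) := by simp only [Matrix.mul_assoc]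
    _ = Y := by rw [mul_eq_one_comm.1 hU, mul_eq_one_comm.1 hW, Matrix.one_mul, Matrix.mul_one]

lemma trace_conjDiagonal_mul_conjDiagonal {U W : Matrix n n ℂ}
    (hW : Wᴴ * W = 1) (r s : n → ℝ) :
    (conjDiagonal W r * conjDiagonal U s).trace.re =
      ∑ i, ∑ j, Complex.normSq ((Uᴴ * W) i j) * (r j * s i) := by
  have h : conjDiagonal U s = U * (Matrix.diagonal (fun i => (s i : ℂ)) * (Uᴴ * W)) * Wᴴ := by
    calc conjDiagonal U s = conjDiagonal U s * (W * Wᴴ) := by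
          rw [mul_eq_one_comm.1 hW, Matrix.mul_one]
      _ = _ := by simp only [conjDiagonal, Matrix.mul_assoc]
  rw [h, trace_conjDiagonal_mul hW, Complex.re_sum]
  refine Finset.sum_congr rfl fun i _ => ?_
  rw [Complex.re_sum]
  refine Finset.sum_congr rfl fun j _ => ?_
  rw [Matrix.diagonal_mul]
  simp only [Complex.normSq_apply, Complex.star_def, Complex.mul_re, Complex.mul_im,
    Complex.conj_re, Complex.conj_im, Complex.ofReal_re, Complex.ofReal_im]
  ring

/-- The relative quasi-entropy with a weight commuting with `ρ`, as a sum over the joint spectrum of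
`ρ` and `σ` with the squared overlaps of the eigenvectors as weights. -/
lemma relativeQuasiEntropy_conjDiagonal {U W : Matrix n n ℂ} (hU : Uᴴ * U = 1)
    (hW : Wᴴ * W = 1) {r s : n → ℝ} (hr : ∀ j, 0 < r j) (f : ℝ → ℝ) (g : n → ℝ) :
    relativeQuasiEntropy f (conjDiagonal W g) (conjDiagonal W r) (conjDiagonal U s) =
      ∑ i, ∑ j, Complex.normSq ((Uᴴ * W) i j) * (r j * g j ^ 2 * f (s i / r j)) := by
  have hX : Uᴴ * conjDiagonal W (fun j => g j * √(r j)) * W =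
      Uᴴ * W * Matrix.diagonal (fun j => ((g j * √(r j) : ℝ) : ℂ)) := by
    calc _ = Uᴴ * W * Matrix.diagonal (fun j => ((g j * √(r j) : ℝ) : ℂ)) * (Wᴴ * W) := by
          simp only [conjDiagonal, Matrix.mul_assoc]
      _ = _ := by rw [hW, Matrix.mul_one]
  rw [relativeQuasiEntropy, cfc_conjDiagonal hW, conjDiagonal_mul_conjDiagonal hW,
    superoperatorCfc_relativeModularOperator hU hW hr, (isHermitian_conjDiagonal W _).eq,
    trace_conjDiagonal_mul hW, hX, Complex.re_sum]
  refine Finset.sum_congr rfl fun i _ => ?_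
  rw [Complex.re_sum]
  refine Finset.sum_congr rfl fun j _ => ?_
  have hs : √(r j) * √(r j) = r j := Real.mul_self_sqrt (hr j).le
  rw [Matrix.of_apply, Matrix.mul_diagonal]
  simp only [Complex.normSq_apply, Complex.star_def, Complex.mul_re, Complex.mul_im,
    Complex.conj_re, Complex.conj_im, Complex.ofReal_re, Complex.ofReal_im]
  linear_combination g j ^ 2 * f (s i / r j) *
    (((Uᴴ * W) i j).re ^ 2 + ((Uᴴ * W) i j).im ^ 2) * hs

lemma relativeQuasiEntropy_one_conjDiagonal {U W : Matrix n n ℂ} (hU : Uᴴ * U = 1)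
    (hW : Wᴴ * W = 1) {r s : n → ℝ} (hr : ∀ j, 0 < r j) (f : ℝ → ℝ) :
    relativeQuasiEntropy f 1 (conjDiagonal W r) (conjDiagonal U s) =
      ∑ i, ∑ j, Complex.normSq ((Uᴴ * W) i j) * r j * f (s i / r j) := by
  have h : (1 : Matrix n n ℂ) = conjDiagonal W (fun _ => 1) := by
    rw [conjDiagonal_const hW, map_one]
  rw [h, relativeQuasiEntropy_conjDiagonal hU hW hr]
  simp only [one_pow, mul_one, mul_assoc]

/-- The weight `(- ln_q ρ)^(1/2)` turns `(q - 1)` times the quasi-entropy into the unweighted one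
and two entropic terms, by the deformed addition rule for `ln_q`. The trace condition keeps the
spectrum of `ρ` in `(0, 1]`, so that the square root is that of a positive matrix. -/
theorem sub_one_mul_relativeQuasiEntropy (q : ℝ) {ρ σ : Matrix n n ℂ} (hρ : ρ.PosDef)
    (hσ : σ.PosDef) (hρ₁ : ρ.trace = 1) :
    (q - 1) * relativeQuasiEntropy (qLog q) (sqrtNegQLog q ρ) ρ σ =
      relativeQuasiEntropy (qLog q) 1 ρ σ - (ρ * cfc (qLog q) σ).trace.re -
        tsallisEntropy q ρ := by
  obtain ⟨W, r, hW, hr, rfl⟩ := exists_eq_conjDiagonal hρ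
  obtain ⟨U, s, hU, hs, rfl⟩ := exists_eq_conjDiagonal hσ
  have hr1 : ∀ j, r j ≤ 1 := by
    intro j
    rw [trace_conjDiagonal hW] at hρ₁
    have h1 : ∑ i, r i = 1 := by exact_mod_cast hρ₁
    rw [← h1]
    exact Finset.single_le_sum (fun i _ => (hr i).le) (Finset.mem_univ j)
  -- Pairing with `1`, diagonalised in the basis `U`, puts the trace over the joint spectrum.
  have hent : tsallisEntropy q (conjDiagonal W r) =
      -∑ i, ∑ j, Complex.normSq ((Uᴴ * W) i j) * (r j * qLog q (r j)) := by
    have h := trace_conjDiagonal_mul_conjDiagonal (U := U) hW (fun j => r j * qLog q (r j))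
      (fun _ => 1)
    rw [conjDiagonal_const hU, map_one, Matrix.mul_one] at h
    rw [tsallisEntropy, cfc_conjDiagonal hW, conjDiagonal_mul_conjDiagonal hW, h]
    simp only [mul_one]
  rw [hent, sqrtNegQLog, cfc_conjDiagonal hW, conjDiagonal_neg, cfc_conjDiagonal hW,
    cfc_conjDiagonal hU, relativeQuasiEntropy_conjDiagonal hU hW hr,
    relativeQuasiEntropy_one_conjDiagonal hU hW hr, trace_conjDiagonal_mul_conjDiagonal hW,
    sub_neg_eq_add, Finset.mul_sum, ← Finset.sum_sub_distrib, ← Finset.sum_add_distrib]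
  refine Finset.sum_congr rfl fun i _ => ?_
  rw [Finset.mul_sum, ← Finset.sum_sub_distrib, ← Finset.sum_add_distrib]
  refine Finset.sum_congr rfl fun j _ => ?_
  rw [Real.sq_sqrt (neg_nonneg.2 (qLog_nonpos q (hr j) (hr1 j)))]
  linear_combination Complex.normSq ((Uᴴ * W) i j) * mul_qLog_div q (hr j) (hs i)

end QuasiEntropy

/-! ### Variational formula and monotonicity -/

section Monotonicity

variable {n m : Type*} [Fintype n] [DecidableEq n] [Fintype m] [DecidableEq m]

/-- The concave quadratic functional of `Y` whose maximum is
`⟨v, (t + Δ(σ/ρ))⁻¹ v⟩` for `v = ρ^(1/2)`. It is `2 Re ⟨v, y⟩ - ⟨y, (t + Δ(σ/ρ)) y⟩` with the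
substitution `y = Y ρ^(1/2)`, which makes it linear in `ρ` and `σ`. -/
def resolventFunctional (t : ℝ) (ρ σ Y : Matrix n n ℂ) : ℝ :=
  2 * (ρ * Y).trace.re - (σ * (Y * Yᴴ)).trace.re - t * (ρ * (Yᴴ * Y)).trace.re

lemma re_trace_conjDiagonal_mul_gram {U W : Matrix n n ℂ} (hU : Uᴴ * U = 1)
    (hW : Wᴴ * W = 1) (s : n → ℝ) (Z : Matrix n n ℂ) :
    (conjDiagonal U s * ((U * Z * Wᴴ) * (U * Z * Wᴴ)ᴴ)).trace.re =
      ∑ i, ∑ j, s i * Complex.normSq (Z i j) := by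
  have e : (U * Z * Wᴴ) * (U * Z * Wᴴ)ᴴ = U * (Z * Zᴴ) * Uᴴ := by
    calc _ = U * Z * (Wᴴ * W) * Zᴴ * Uᴴ := by
          simp only [Matrix.conjTranspose_mul, Matrix.conjTranspose_conjTranspose, Matrix.mul_assoc]
      _ = _ := by rw [hW]; simp only [Matrix.mul_one, Matrix.mul_assoc]
  rw [e, trace_conjDiagonal_mul hU, hU, Complex.re_sum]
  refine Finset.sum_congr rfl fun i _ => ?_
  simp only [Matrix.one_apply, Complex.re_sum]
  rw [Finset.sum_eq_single i (by intro b _ hb; simp [hb.symm]) (by simp)]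
  simp [Matrix.mul_apply, Complex.normSq_apply, Finset.mul_sum]

lemma resolventFunctional_conjDiagonal {U W : Matrix n n ℂ} (hU : Uᴴ * U = 1) (hW : Wᴴ * W = 1)
    (t : ℝ) (r s : n → ℝ) (Z : Matrix n n ℂ) :
    resolventFunctional t (conjDiagonal W r) (conjDiagonal U s) (U * Z * Wᴴ) =
      ∑ i, ∑ j, (2 * (r j * (star ((Uᴴ * W) i j) * Z i j).re) -
        (s i + t * r j) * Complex.normSq (Z i j)) := by
  have e : (U * Z * Wᴴ)ᴴ = W * Zᴴ * Uᴴ := by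
    simp only [Matrix.conjTranspose_mul, Matrix.conjTranspose_conjTranspose, Matrix.mul_assoc]
  have h := re_trace_conjDiagonal_mul_gram hW hU r Zᴴ
  rw [← e, Matrix.conjTranspose_conjTranspose, Finset.sum_comm] at h
  rw [resolventFunctional, re_trace_conjDiagonal_mul_gram hU hW, h, trace_conjDiagonal_mul hW,
    Complex.re_sum,
    Finset.mul_sum, Finset.mul_sum, ← Finset.sum_sub_distrib, ← Finset.sum_sub_distrib]
  refine Finset.sum_congr rfl fun i _ => ?_
  rw [Complex.re_sum, Finset.mul_sum, Finset.mul_sum, ← Finset.sum_sub_distrib,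
    ← Finset.sum_sub_distrib]
  refine Finset.sum_congr rfl fun j _ => ?_
  rw [Complex.re_ofReal_mul, Matrix.conjTranspose_apply, Complex.star_def, Complex.normSq_conj]
  ring

/-- One half of the variational formula: the resolvent quasi-entropy bounds its functional. -/
lemma resolventFunctional_le {ρ σ : Matrix n n ℂ} (hρ : ρ.PosDef) (hσ : σ.PosDef) {t : ℝ}
    (ht : 0 < t) (Y : Matrix n n ℂ) :
    resolventFunctional t ρ σ Y ≤ relativeQuasiEntropy (fun x => (t + x)⁻¹) 1 ρ σ := by
  obtain ⟨W, r, hW, hr, rfl⟩ := exists_eq_conjDiagonal hρ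
  obtain ⟨U, s, hU, hs, rfl⟩ := exists_eq_conjDiagonal hσ
  rw [← mul_conjTranspose_mul_mul hU hW Y, resolventFunctional_conjDiagonal hU hW,
    relativeQuasiEntropy_one_conjDiagonal hU hW hr]
  refine Finset.sum_le_sum fun i _ => Finset.sum_le_sum fun j _ => ?_
  generalize (Uᴴ * W) i j = w
  generalize (Uᴴ * Y * W) i j = z
  have hr' := hr j
  have hs' := hs i
  have hc : 0 < s i + t * r j := by positivity
  -- Completing the square in `z`.
  have key : Complex.normSq w * r j * (t + s i / r j)⁻¹ -
      (2 * (r j * (star w * z).re) - (s i + t * r j) * Complex.normSq z) =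
      (s i + t * r j)⁻¹ * Complex.normSq ((s i + t * r j : ℝ) * z - (r j : ℝ) * w) := by
    have : t + s i / r j = (s i + t * r j) / r j := by field_simp; ring
    rw [this]
    simp only [Complex.normSq_apply, Complex.star_def, Complex.mul_re, Complex.mul_im,
      Complex.conj_re, Complex.conj_im, Complex.ofReal_re, Complex.ofReal_im, Complex.sub_re,
      Complex.sub_im]
    generalize s i + t * r j = c at hc ⊢
    field_simp
    ring
  have : 0 ≤ (s i + t * r j)⁻¹ * Complex.normSq ((s i + t * r j : ℝ) * z - (r j : ℝ) * w) :=
    mul_nonneg (inv_nonneg.2 hc.le) (Complex.normSq_nonneg _)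
  linarith

/-- The other half of the variational formula: the bound is attained. -/
lemma exists_resolventFunctional_eq {ρ σ : Matrix n n ℂ} (hρ : ρ.PosDef) (hσ : σ.PosDef) {t : ℝ}
    (ht : 0 < t) :
    ∃ Y, resolventFunctional t ρ σ Y = relativeQuasiEntropy (fun x => (t + x)⁻¹) 1 ρ σ := by
  obtain ⟨W, r, hW, hr, rfl⟩ := exists_eq_conjDiagonal hρ
  obtain ⟨U, s, hU, hs, rfl⟩ := exists_eq_conjDiagonal hσ
  -- The maximiser solves `σ Y + t Y ρ = ρ`.
  refine ⟨U * (Matrix.of fun i j => ((r j / (s i + t * r j) : ℝ) : ℂ) * (Uᴴ * W) i j) * Wᴴ, ?_⟩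
  rw [resolventFunctional_conjDiagonal hU hW, relativeQuasiEntropy_one_conjDiagonal hU hW hr]
  refine Finset.sum_congr rfl fun i _ => Finset.sum_congr rfl fun j _ => ?_
  rw [Matrix.of_apply]
  generalize (Uᴴ * W) i j = w
  have hr' := hr j
  have hs' := hs i
  have hc : 0 < s i + t * r j := by positivity
  have : t + s i / r j = (s i + t * r j) / r j := by field_simp; ring
  rw [this]
  simp only [Complex.normSq_apply, Complex.star_def, Complex.mul_re, Complex.mul_im,
    Complex.conj_re, Complex.conj_im, Complex.ofReal_re, Complex.ofReal_im]
  generalize s i + t * r j = c at hc ⊢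
  field_simp
  ring

lemma sum_overlap_mul_eq {U W : Matrix n n ℂ} (hU : Uᴴ * U = 1)
    (hW : Wᴴ * W = 1) (r : n → ℝ) :
    ∑ i, ∑ j, Complex.normSq ((Uᴴ * W) i j) * r j = (conjDiagonal W r).trace.re := by
  have h := trace_conjDiagonal_mul_conjDiagonal (U := U) hW r (fun _ => 1)
  rw [conjDiagonal_const hU, map_one, Matrix.mul_one] at h
  simp only [h, mul_one]

lemma sum_overlap_mul_div_eq {U W : Matrix n n ℂ} (hW : Wᴴ * W = 1)
    {r : n → ℝ} (hr : ∀ j, 0 < r j) (s : n → ℝ) :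
    ∑ i, ∑ j, Complex.normSq ((Uᴴ * W) i j) * r j * (s i / r j) = (conjDiagonal U s).trace.re := by
  have h := trace_conjDiagonal_mul_conjDiagonal (U := U) hW (fun _ => 1) s
  rw [conjDiagonal_const hW, map_one, Matrix.one_mul] at h
  rw [h]
  refine Finset.sum_congr rfl fun i _ => Finset.sum_congr rfl fun j _ => ?_
  have := (hr j).ne'
  field_simp

/-- Monotonicity of the relative quasi-entropy for `ln_q` under passage to a subsystem. The
restriction of states is encoded by a unital inclusion `E` of the smaller matrix algebra: `ρ'` and
`σ'` are the matrices that represent the functionals `Tr (ρ E(·))` and `Tr (σ E(·))`. -/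
theorem relativeQuasiEntropy_qLog_mono {q : ℝ} (hq₀ : 0 < q) (hq₂ : q ≤ 2) {ρ σ : Matrix n n ℂ}
    {ρ' σ' : Matrix m m ℂ} (hρ : ρ.PosDef) (hσ : σ.PosDef) (hρ' : ρ'.PosDef) (hσ' : σ'.PosDef)
    (E : Matrix m m ℂ →⋆ₐ[ℂ] Matrix n n ℂ) (hEρ : ∀ Y, (ρ * E Y).trace = (ρ' * Y).trace)
    (hEσ : ∀ Y, (σ * E Y).trace = (σ' * Y).trace) :
    relativeQuasiEntropy (qLog q) 1 ρ σ ≤ relativeQuasiEntropy (qLog q) 1 ρ' σ' := by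
  have hres : ∀ t, 0 < t → relativeQuasiEntropy (fun x => (t + x)⁻¹) 1 ρ' σ' ≤
      relativeQuasiEntropy (fun x => (t + x)⁻¹) 1 ρ σ := by
    intro t ht
    -- The inclusion of the smaller maximiser is a test matrix for the larger functional, and the
    -- functional does not change under inclusion.
    obtain ⟨Y, hY⟩ := exists_resolventFunctional_eq hρ' hσ' ht
    refine le_trans (le_of_eq ?_) (resolventFunctional_le hρ hσ ht (E Y))
    have hE : (E Y)ᴴ = E Yᴴ := (map_star E Y).symm
    rw [← hY, resolventFunctional, resolventFunctional, hE, ← map_mul, ← map_mul, hEρ, hEρ, hEσ]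
  have htr : ρ.trace = ρ'.trace := by simpa using hEρ 1
  have hts : σ.trace = σ'.trace := by simpa using hEσ 1
  obtain ⟨W, r, hW, hr, rfl⟩ := exists_eq_conjDiagonal hρ
  obtain ⟨U, s, hU, hs, rfl⟩ := exists_eq_conjDiagonal hσ
  obtain ⟨W', r', hW', hr', rfl⟩ := exists_eq_conjDiagonal hρ'
  obtain ⟨U', s', hU', hs', rfl⟩ := exists_eq_conjDiagonal hσ'
  simp only [relativeQuasiEntropy_one_conjDiagonal hU hW hr,
    relativeQuasiEntropy_one_conjDiagonal hU' hW' hr', ← Fintype.sum_prod_type'] at hres ⊢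
  refine sum_mul_qLog_le hq₀ hq₂ (fun p => div_pos (hs _) (hr _)) (fun p => div_pos (hs' _) (hr' _))
    ?_ ?_ hres
  · rw [Fintype.sum_prod_type, Fintype.sum_prod_type, sum_overlap_mul_eq hU hW,
      sum_overlap_mul_eq hU' hW', htr]
  · rw [Fintype.sum_prod_type, Fintype.sum_prod_type, sum_overlap_mul_div_eq hW hr,
      sum_overlap_mul_div_eq hW' hr', hts]

end Monotonicity

/-! ### Partial traces -/

section PartialTrace

variable {m n n₁ n₂ n₃ : Type*}

lemma trace_mul_kronecker_one [Fintype m] [Fintype n] [DecidableEq n]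
    (A : Matrix (m × n) (m × n) ℂ) (B : Matrix m m ℂ) :
    (A * (B ⊗ₖ (1 : Matrix n n ℂ))).trace = (partialTraceRight A * B).trace := by
  simp only [Matrix.trace, Matrix.diag_apply, Matrix.mul_apply, Fintype.sum_prod_type,
    Matrix.kroneckerMap_apply, Matrix.one_apply, partialTraceRight, Matrix.of_apply,
    mul_ite, mul_one, mul_zero, Finset.sum_ite_eq', Finset.mem_univ, if_true, Finset.sum_mul]
  exact Finset.sum_congr rfl fun i _ => Finset.sum_comm

lemma trace_mul_one_kronecker [Fintype m] [DecidableEq m] [Fintype n]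
    (A : Matrix (m × n) (m × n) ℂ) (B : Matrix n n ℂ) :
    (A * ((1 : Matrix m m ℂ) ⊗ₖ B)).trace = (partialTraceLeft A * B).trace := by
  have h (a : m) (i : n) :
      ∑ b, ∑ j, A (a, i) (b, j) * ((1 : Matrix m m ℂ) b a * B j i) =
        ∑ j, A (a, i) (a, j) * B j i := by
    rw [Finset.sum_eq_single a (by intro b _ hb; simp [Matrix.one_apply_ne hb]) (by simp)]
    simp
  simp only [Matrix.trace, Matrix.diag_apply, Matrix.mul_apply, Fintype.sum_prod_type,
    Matrix.kroneckerMap_apply, partialTraceLeft, Matrix.of_apply, h, Finset.sum_mul]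
  rw [Finset.sum_comm]
  exact Finset.sum_congr rfl fun i _ => Finset.sum_comm

lemma posDef_partialTraceRight [Fintype n] [Nonempty n] {A : Matrix (m × n) (m × n) ℂ}
    (hA : A.PosDef) : (partialTraceRight A).PosDef := by
  have h : partialTraceRight A = ∑ k, A.submatrix (fun i => (i, k)) (fun i => (i, k)) := by
    ext i j; simp [partialTraceRight, Matrix.sum_apply]
  rw [h]
  exact Matrix.posDef_sum Finset.univ_nonempty fun k _ =>
    hA.submatrix fun i j hij => congrArg Prod.fst hij

lemma posDef_partialTraceLeft [Fintype m] [Nonempty m] {A : Matrix (m × n) (m × n) ℂ}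
    (hA : A.PosDef) : (partialTraceLeft A).PosDef := by
  have h : partialTraceLeft A = ∑ k, A.submatrix (fun i => (k, i)) (fun i => (k, i)) := by
    ext i j; simp [partialTraceLeft, Matrix.sum_apply]
  rw [h]
  exact Matrix.posDef_sum Finset.univ_nonempty fun k _ =>
    hA.submatrix fun i j hij => congrArg Prod.snd hij

variable [Fintype n₁] [Fintype n₃] [DecidableEq n₃]

lemma reduced23_reduced12_kronecker_one (ρ : Matrix ((n₁ × n₂) × n₃) ((n₁ × n₂) × n₃) ℂ) :
    reduced23 (reduced12 ρ ⊗ₖ (1 : Matrix n₃ n₃ ℂ)) = reduced2 ρ ⊗ₖ (1 : Matrix n₃ n₃ ℂ) := by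
  ext ⟨i, k⟩ ⟨j, l⟩
  change ∑ x, (∑ y, ρ ((x, i), y) ((x, j), y)) * (1 : Matrix n₃ n₃ ℂ) k l =
    (∑ y, ∑ x, ρ ((x, i), y) ((x, j), y)) * (1 : Matrix n₃ n₃ ℂ) k l
  rw [← Finset.sum_mul, Finset.sum_comm]

variable [DecidableEq n₁] [Fintype n₂] [DecidableEq n₂]

/-- The inclusion `Y ↦ I₁ ⊗ Y` of the observables of the last two factors, with the associativity
of the tensor product made explicit. -/
def includeLastTwo : Matrix (n₂ × n₃) (n₂ × n₃) ℂ →⋆ₐ[ℂ]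
    Matrix ((n₁ × n₂) × n₃) ((n₁ × n₂) × n₃) ℂ where
  toFun Y := ((1 : Matrix n₁ n₁ ℂ) ⊗ₖ Y).submatrix (Equiv.prodAssoc n₁ n₂ n₃)
    (Equiv.prodAssoc n₁ n₂ n₃)
  map_one' := by simp
  map_mul' X Y := by
    rw [Matrix.submatrix_mul_equiv, ← Matrix.mul_kronecker_mul, Matrix.one_mul]
  map_zero' := by simp
  map_add' X Y := by rw [Matrix.kronecker_add, Matrix.submatrix_add]; rfl
  commutes' c := by
    rw [Algebra.algebraMap_eq_smul_one, Matrix.kronecker_smul, Matrix.submatrix_smul]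
    simp [Algebra.algebraMap_eq_smul_one]
  map_star' Y := by
    rw [Matrix.star_eq_conjTranspose, Matrix.star_eq_conjTranspose, Matrix.conjTranspose_submatrix,
      Matrix.conjTranspose_kronecker, Matrix.conjTranspose_one]

lemma trace_mul_includeLastTwo (ρ : Matrix ((n₁ × n₂) × n₃) ((n₁ × n₂) × n₃) ℂ)
    (Y : Matrix (n₂ × n₃) (n₂ × n₃) ℂ) :
    (ρ * includeLastTwo Y).trace = (reduced23 ρ * Y).trace := by
  have h : ρ * includeLastTwo Y = (Matrix.reindex (Equiv.prodAssoc n₁ n₂ n₃)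
      (Equiv.prodAssoc n₁ n₂ n₃) ρ * ((1 : Matrix n₁ n₁ ℂ) ⊗ₖ Y)).submatrix
        (Equiv.prodAssoc n₁ n₂ n₃) (Equiv.prodAssoc n₁ n₂ n₃) := by
    rw [← Matrix.submatrix_mul_equiv _ _ _ (Equiv.prodAssoc n₁ n₂ n₃)]
    simp [includeLastTwo]
  rw [reduced23, ← trace_mul_one_kronecker, h, Matrix.trace, Matrix.trace]
  exact Equiv.sum_comp (Equiv.prodAssoc n₁ n₂ n₃) (fun x => (Matrix.reindex
    (Equiv.prodAssoc n₁ n₂ n₃) (Equiv.prodAssoc n₁ n₂ n₃) ρ * ((1 : Matrix n₁ n₁ ℂ) ⊗ₖ Y)) x x)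

end PartialTrace

/-- The deformed logarithm `ln_1` is the natural one. -/
lemma tsallisEntropy_one {n : Type*} [Fintype n] [DecidableEq n] (D : Matrix n n ℂ) :
    tsallisEntropy 1 D = vonNeumannEntropy D := by
  have h : qLog 1 = Real.log := funext fun x => if_pos rfl
  rw [tsallisEntropy, vonNeumannEntropy, h]

theorem theorem2 {n₁ n₂ n₃ : Type*} [Fintype n₁] [DecidableEq n₁] [Fintype n₂] [DecidableEq n₂]
    [Fintype n₃] [DecidableEq n₃] (q : ℝ) (hq₀ : 0 < q) (hq₂ : q ≤ 2)
    (ρ : Matrix ((n₁ × n₂) × n₃) ((n₁ × n₂) × n₃) ℂ) (hρ : ρ.PosDef) (hρ₁ : ρ.trace = 1) :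
    (q - 1) *
        (relativeQuasiEntropy (qLog q) (sqrtNegQLog q ρ)
            ρ (reduced12 ρ ⊗ₖ (1 : Matrix n₃ n₃ ℂ)) -
          relativeQuasiEntropy (qLog q) (sqrtNegQLog q (reduced23 ρ))
            (reduced23 ρ) (reduced2 ρ ⊗ₖ (1 : Matrix n₃ n₃ ℂ))) ≤
      tsallisEntropy q (reduced12 ρ) + tsallisEntropy q (reduced23 ρ) -
        tsallisEntropy q ρ - tsallisEntropy q (reduced2 ρ) ∧
    (q = 1 →
      vonNeumannEntropy ρ + vonNeumannEntropy (reduced2 ρ) ≤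
        vonNeumannEntropy (reduced12 ρ) + vonNeumannEntropy (reduced23 ρ)) := by
  -- A matrix of trace `1` has a nonempty index type, so partial traces stay positive definite.
  have hne : Nonempty ((n₁ × n₂) × n₃) := by
    by_contra h
    rw [not_nonempty_iff] at h
    simp [Matrix.trace] at hρ₁
  obtain ⟨⟨⟨i₁, -⟩, i₃⟩⟩ := hne
  have : Nonempty n₁ := ⟨i₁⟩
  have : Nonempty n₃ := ⟨i₃⟩
  have h12 : (reduced12 ρ).PosDef := posDef_partialTraceRight hρ
  have h23 : (reduced23 ρ).PosDef :=
    posDef_partialTraceLeft (hρ.submatrix (Equiv.prodAssoc n₁ n₂ n₃).symm.injective)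
  have h2 : (reduced2 ρ).PosDef := posDef_partialTraceRight h23
  have h12' : (reduced12 ρ ⊗ₖ (1 : Matrix n₃ n₃ ℂ)).PosDef := h12.kronecker .one
  have h2' : (reduced2 ρ ⊗ₖ (1 : Matrix n₃ n₃ ℂ)).PosDef := h2.kronecker .one
  have h23tr : (reduced23 ρ).trace = 1 := by
    rw [← hρ₁]
    simpa using (trace_mul_includeLastTwo ρ 1).symm
  have hmono := relativeQuasiEntropy_qLog_mono hq₀ hq₂ hρ h12' h23 h2' includeLastTwo
    (trace_mul_includeLastTwo ρ) (fun Y => by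
      rw [trace_mul_includeLastTwo, reduced23_reduced12_kronecker_one])
  have e123 := sub_one_mul_relativeQuasiEntropy q hρ h12' hρ₁
  have e23 := sub_one_mul_relativeQuasiEntropy q h23 h2' h23tr
  rw [cfc_kronecker_one h12, trace_mul_kronecker_one] at e123
  rw [cfc_kronecker_one h2, trace_mul_kronecker_one] at e23
  have t12 : tsallisEntropy q (reduced12 ρ) =
      -((partialTraceRight ρ * cfc (qLog q) (reduced12 ρ)).trace.re) := rfl
  have t2 : tsallisEntropy q (reduced2 ρ) =
      -((partialTraceRight (reduced23 ρ) * cfc (qLog q) (reduced2 ρ)).trace.re) := rfl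
  have main : (q - 1) *
        (relativeQuasiEntropy (qLog q) (sqrtNegQLog q ρ)
            ρ (reduced12 ρ ⊗ₖ (1 : Matrix n₃ n₃ ℂ)) -
          relativeQuasiEntropy (qLog q) (sqrtNegQLog q (reduced23 ρ))
            (reduced23 ρ) (reduced2 ρ ⊗ₖ (1 : Matrix n₃ n₃ ℂ))) ≤
      tsallisEntropy q (reduced12 ρ) + tsallisEntropy q (reduced23 ρ) -
        tsallisEntropy q ρ - tsallisEntropy q (reduced2 ρ) := by
    rw [mul_sub, e123, e23]
    linarith
  refine ⟨main, ?_⟩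
  rintro rfl
  simp only [sub_self, zero_mul, tsallisEntropy_one] at main
  linarith
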